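/- For a group $Q$ write $x^y=y^{-1}xy$ and $[x,y]=x^{-1}y^{-1}xy$. Let $Q\wedge Q$ be the non-abelian exterior square of $Q$, i.e. the group generated by the symbols $x\wedge y$ ($x,y\in Q$) subject to the relations $$xy\wedge z=(x^y\wedge z^y)(y\wedge z),\qquad x\wedge yz=(x\wedge z)(x^z\wedge y^z),\qquad x\wedge x=1\qquad(x,y,z\in Q).$$ Let $\mathrm{M}(Q)$ be the kernel of the homomorphism $Q\wedge Q\to[Q,Q]$, $x\wedge y\mapsto[x,y]$, let $\mathrm{M}_0(Q)=\langle x\wedge y\mid x,y\in Q,\ [x,y]=1\rangle$, which is a normal subgroup of $Q\wedge Q$ contained in $\mathrm{M}(Q)$, and let $\mathrm{B}_0(Q)=\mathrm{M}(Q)/\mathrm{M}_0(Q)$ be the Bogomolov multiplier of $Q$. Write $\mathrm{d}(A)$ for the minimal number of generators of a finitely generated group $A$, and $A^{\mathrm{ab}}=A/[A,A]$. **Proposition.** Let $Q$ be a finite group and $S$ a normal subgroup of $Q$ such that $Q/S$ is cyclic. Then $\mathrm{B}_0(Q)$ and $\mathrm{B}_0(S)$ are finite, $|\mathrm{B}_0(Q)|$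 divides $|\mathrm{B}_0(S)|\cdot|S^{\mathrm{ab}}|$, and $\mathrm{d}(\mathrm{B}_0(Q))\le \mathrm{d}(\mathrm{B}_0(S))+\mathrm{d}(S^{\mathrm{ab}})$. -/

import Mathlib

/-!
Throughout, conjugation and commutators follow the right-handed convention
`x ^ y = y⁻¹ x y` and `[x, y] = x⁻¹ y⁻¹ x y`.
-/

namespace Bogomolov

universe u

section Definitions

variable (Q : Type u) [Group Q]

variable {Q} in
/-- Right conjugation `x ^ y = y⁻¹ x y`. -/
def rconj (x y : Q) : Q := y⁻¹ * x * y

variable {Q} in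
/-- The commutator `[x, y] = x⁻¹ y⁻¹ x y`. -/
def comm (x y : Q) : Q := x⁻¹ * y⁻¹ * x * y

variable {Q} in
/-- The free generator attached to the symbol `x ∧ y`. -/
def sym (x y : Q) : FreeGroup (Q × Q) := FreeGroup.of (x, y)

/-- The relators of the non-abelian exterior square:
`xy ∧ z = (x^y ∧ z^y)(y ∧ z)`, `x ∧ yz = (x ∧ z)(x^z ∧ y^z)`, `x ∧ x = 1`. -/
def extRels : Set (FreeGroup (Q × Q)) :=
  {r | ∃ x y z : Q, r = sym (x * y) z * (sym (rconj x y) (rconj z y) * sym y z)⁻¹} ∪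
  {r | ∃ x y z : Q, r = sym x (y * z) * (sym x z * sym (rconj x z) (rconj y z))⁻¹} ∪
  {r | ∃ x : Q, r = sym x x}

/-- The non-abelian exterior square `Q ∧ Q`. -/
abbrev ExtSquare : Type u := PresentedGroup (extRels Q)

variable {Q} in
/-- The generator `x ∧ y` of `Q ∧ Q`. -/
def wedge (x y : Q) : ExtSquare Q := PresentedGroup.of (x, y)

theorem lift_comm_eq_one : ∀ r ∈ extRels Q,
    FreeGroup.lift (fun p : Q × Q => comm p.1 p.2) r = 1 := by
  rintro r ((⟨x, y, z, rfl⟩ | ⟨x, y, z, rfl⟩) | ⟨x, rfl⟩) <;>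
    simp [sym, comm, rconj] <;> group

/-- The commutator map `Q ∧ Q → Q`, `x ∧ y ↦ [x, y]`; its image is the derived subgroup. -/
def commMap : ExtSquare Q →* Q :=
  PresentedGroup.toGroup (lift_comm_eq_one Q)

/-- `M(Q)`: the kernel of the commutator map. -/
def M : Subgroup (ExtSquare Q) := (commMap Q).ker

/-- `M₀(Q)`: the subgroup generated by all `x ∧ y` with `[x, y] = 1`. -/
def M₀ : Subgroup (ExtSquare Q) :=
  Subgroup.closure {w | ∃ x y : Q, comm x y = 1 ∧ w = wedge x y}

end Definitions

section Normality

variable {Q : Type u} [Group Q]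

theorem commMap_wedge (x y : Q) : commMap Q (wedge x y) = comm x y :=
  PresentedGroup.toGroup.of _

theorem wedge_mul_left (x y z : Q) :
    wedge (x * y) z = wedge (rconj x y) (rconj z y) * wedge y z := by
  have h := PresentedGroup.one_of_mem (rels := extRels Q)
    (x := sym (x * y) z * (sym (rconj x y) (rconj z y) * sym y z)⁻¹)
    (Or.inl (Or.inl ⟨x, y, z, rfl⟩))
  rw [map_mul, map_inv, mul_inv_eq_one, map_mul] at h
  exact h

theorem wedge_mul_right (x y z : Q) :
    wedge x (y * z) = wedge x z * wedge (rconj x z) (rconj y z) := by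
  have h := PresentedGroup.one_of_mem (rels := extRels Q)
    (x := sym x (y * z) * (sym x z * sym (rconj x z) (rconj y z))⁻¹)
    (Or.inl (Or.inr ⟨x, y, z, rfl⟩))
  rw [map_mul, map_inv, mul_inv_eq_one, map_mul] at h
  exact h

theorem rconj_mul (x y z : Q) : rconj (x * y) z = rconj x z * rconj y z := by
  simp only [rconj]; group

theorem rconj_rconj (x y z : Q) : rconj (rconj x y) z = rconj x (y * z) := by
  simp only [rconj]; group

theorem mul_rconj (y w : Q) : w * rconj y w = y * w := by
  simp only [rconj]; group

theorem wedge_interchange (x y z w : Q) :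
    wedge (rconj x (w * y)) (rconj z (w * y)) * wedge y w =
      wedge y w * wedge (rconj x (y * w)) (rconj z (y * w)) := by
  have h1 : wedge (x * y) (z * w) =
      wedge (rconj x y) (rconj w y) * (wedge (rconj x (w * y)) (rconj z (w * y)) *
        wedge y w) * wedge (rconj y w) (rconj z w) := by
    rw [wedge_mul_left, rconj_mul, wedge_mul_right, wedge_mul_right y, rconj_rconj,
      rconj_rconj, mul_rconj]
    simp only [mul_assoc]
  have h2 : wedge (x * y) (z * w) =
      wedge (rconj x y) (rconj w y) * (wedge y w *
        wedge (rconj x (y * w)) (rconj z (y * w))) * wedge (rconj y w) (rconj z w) := by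
    rw [wedge_mul_right, rconj_mul, wedge_mul_left, wedge_mul_left (rconj x w), rconj_rconj,
      rconj_rconj, mul_rconj]
    simp only [mul_assoc]
  exact mul_left_cancel (mul_right_cancel (h1.symm.trans h2))

/-- Conjugation by `y ∧ w` in `Q ∧ Q` is the diagonal action of `[y, w]`. -/
theorem wedge_conj (a b y w : Q) :
    (wedge y w)⁻¹ * wedge a b * wedge y w =
      wedge (rconj a (comm y w)) (rconj b (comm y w)) := by
  have h := wedge_interchange (rconj a (w * y)⁻¹) y (rconj b (w * y)⁻¹) w
  have e : (w * y)⁻¹ * (y * w) = comm y w := by simp only [comm]; group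
  have i : ∀ t : Q, rconj t 1 = t := fun t => by simp [rconj]
  simp only [rconj_rconj, inv_mul_cancel, e, i] at h
  rw [mul_assoc, h, inv_mul_cancel_left]

theorem comm_rconj (a b c : Q) : comm (rconj a c) (rconj b c) = rconj (comm a b) c := by
  simp only [comm, rconj]; group

theorem closure_wedge :
    Subgroup.closure (Set.range fun p : Q × Q => wedge p.1 p.2) = ⊤ :=
  PresentedGroup.closure_range_of (extRels Q)

instance M₀_normal : (M₀ Q).Normal := by
  rw [← Subgroup.normalizer_eq_top_iff, eq_top_iff, ← closure_wedge, Subgroup.closure_le]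
  have key : ∀ (g : ExtSquare Q) (c : Q),
      (∀ a b : Q, g⁻¹ * wedge a b * g = wedge (rconj a c) (rconj b c)) →
      ∀ n ∈ M₀ Q, g⁻¹ * n * g ∈ M₀ Q := by
    intro g c hg n hn
    induction hn using Subgroup.closure_induction with
    | mem n hn =>
      obtain ⟨a, b, hab, rfl⟩ := hn
      rw [hg]
      refine Subgroup.subset_closure ⟨_, _, ?_, rfl⟩
      rw [comm_rconj, hab]
      simp [rconj]
    | one => simp
    | mul x y _ _ hx hy =>
      have := mul_mem hx hy
      simpa [mul_assoc] using this
    | inv x _ hx =>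
      have := inv_mem hx
      simpa [mul_assoc] using this
  rintro _ ⟨⟨y, w⟩, rfl⟩
  rw [SetLike.mem_coe, Subgroup.mem_normalizer_iff]
  have hfwd := key (wedge y w) (comm y w) fun a b => wedge_conj a b y w
  have hbwd := key (wedge y w)⁻¹ (comm y w)⁻¹ fun a b => by
    have h := wedge_conj (rconj a (comm y w)⁻¹) (rconj b (comm y w)⁻¹) y w
    have i : ∀ t : Q, rconj t 1 = t := fun t => by simp [rconj]
    simp only [rconj_rconj, inv_mul_cancel, i] at h
    rw [← h]
    group
  intro n
  constructor
  · intro hn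
    simpa using hbwd n hn
  · intro hn
    have := hfwd _ hn
    simpa [mul_assoc] using this

theorem M₀_le_M : M₀ Q ≤ M Q := by
  rw [M₀, Subgroup.closure_le]
  rintro _ ⟨x, y, h, rfl⟩
  exact (MonoidHom.mem_ker).2 ((commMap_wedge x y).trans h)

end Normality

section Multiplier

variable (Q : Type u) [Group Q]

/-- The Bogomolov multiplier `B₀(Q) = M(Q) / M₀(Q)`. -/
abbrev B₀ : Type u := M Q ⧸ (M₀ Q).subgroupOf (M Q)

instance M_fg [Finite Q] : Group.FG (M Q) := by
  have : Group.FG (ExtSquare Q) :=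
    Group.fg_of_surjective (PresentedGroup.mk_surjective (extRels Q))
  have : (M Q).FiniteIndex := Subgroup.finiteIndex_ker (commMap Q)
  infer_instance

end Multiplier

end Bogomolov

/-! ### Minimal numbers of generators. -/

namespace Group

/-! Let `I = relSub S` be generated by the image of `S ∧ S` and by `M₀ Q`. Since `[v, w] = ∂v ∧ ∂w`
in `Q ∧ Q`, where `∂ = commMap`, and `Q/S` is cyclic, `I` contains all commutators and `(Q ∧ Q)/I`
is abelian. If `g` generates `Q` modulo `S`, then `s ↦ s ∧ g` induces a surjection from the
abelianization of `S` onto `(Q ∧ Q)/I` (`abWedgeRight_surjective`). The sequence `B₀ S → B₀ Q → (Q ∧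
Q)/I` is exact (`range_cores`), so `B₀ Q` is an extension of a subgroup of a quotient of that
abelianization by a quotient of `B₀ S`. Both bounds follow.

Finiteness comes from that of `Q ∧ Q`: it has finitely many commutators, and its abelianization is
finitely generated and torsion. -/

theorem rank_le_rank_ker_add_rank_range {G H : Type*} [Group G] [Group H] (f : G →* H)
    [Group.FG G] [Group.FG f.ker] [Group.FG f.range] :
    Group.rank G ≤ Group.rank f.ker + Group.rank f.range := by
  classical
  obtain ⟨s, hs, hs'⟩ := Group.rank_spec f.ker
  obtain ⟨t, ht, ht'⟩ := Group.rank_spec f.range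
  have hsec : ∀ y : f.range, ∃ x : G, f.rangeRestrict x = y := f.rangeRestrict_surjective
  choose σ hσ using hsec
  have hgen : Subgroup.closure ((s.image Subtype.val ∪ t.image σ : Finset G) : Set G) = ⊤ := by
    set K := Subgroup.closure ((s.image Subtype.val ∪ t.image σ : Finset G) : Set G) with hK
    have hker : f.ker ≤ K := by
      have h : f.ker = (Subgroup.closure (s : Set f.ker)).map f.ker.subtype := by
        rw [hs', ← MonoidHom.range_eq_map, Subgroup.range_subtype]
      rw [h, MonoidHom.map_closure]
      refine Subgroup.closure_mono ?_
      rintro _ ⟨x, hx, rfl⟩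
      simp only [Finset.coe_union, Finset.coe_image]
      exact Or.inl ⟨x, hx, rfl⟩
    have hrange : K.map f.rangeRestrict = ⊤ := by
      rw [eq_top_iff, ← ht', Subgroup.closure_le]
      intro y hy
      refine ⟨σ y, Subgroup.subset_closure ?_, hσ y⟩
      simp only [Finset.coe_union, Finset.coe_image]
      exact Or.inr ⟨y, hy, rfl⟩
    rw [eq_top_iff]
    intro x _
    obtain ⟨k, hk, hkx⟩ : f.rangeRestrict x ∈ K.map f.rangeRestrict := by
      rw [hrange]; trivial
    have hx : x * k⁻¹ ∈ f.ker := by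
      have h : f k = f x := congrArg Subtype.val hkx
      rw [MonoidHom.mem_ker, map_mul, map_inv, h, mul_inv_cancel]
    simpa using mul_mem (hker hx) hk
  calc Group.rank G ≤ (s.image Subtype.val ∪ t.image σ : Finset G).card := Group.rank_le hgen
    _ ≤ (s.image Subtype.val).card + (t.image σ).card := Finset.card_union_le _ _
    _ ≤ s.card + t.card := add_le_add Finset.card_image_le Finset.card_image_le
    _ = _ := by rw [hs, ht]

/-- The minimal number of generators is monotone for subgroups of commutative groups. -/
theorem rank_subgroup_le {A : Type*} [CommGroup A] [Group.FG A] (T : Subgroup A)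
    [Group.FG T] : Group.rank T ≤ Group.rank A := by
  classical
  obtain ⟨s, hs, hs'⟩ := Group.rank_spec A
  let L : (s → ℤ) →ₗ[ℤ] Additive A := Fintype.linearCombination ℤ fun a : s => Additive.ofMul a.1
  have hL : ∀ x : A, ∃ v, (L v).toMul = x := by
    intro x
    have hx : x ∈ Subgroup.closure (s : Set A) := by rw [hs']; trivial
    induction hx using Subgroup.closure_induction with
    | mem x hx =>
      refine ⟨Pi.single ⟨x, hx⟩ 1, ?_⟩
      simp [L, Fintype.linearCombination_apply_single]
    | one => exact ⟨0, by simp⟩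
    | mul x y _ _ hx hy =>
      obtain ⟨v, rfl⟩ := hx
      obtain ⟨w, rfl⟩ := hy
      exact ⟨v + w, by simp⟩
    | inv x _ hx =>
      obtain ⟨v, rfl⟩ := hx
      exact ⟨-v, by simp⟩
  -- The preimage of `T` in `ℤ^s` is free of rank at most `|s|`, and a basis of it maps to
  -- generators of `T`.
  let N : Submodule ℤ (s → ℤ) := (AddSubgroup.toIntSubmodule T.toAddSubgroup).comap L
  obtain ⟨n, ⟨b⟩⟩ := N.nonempty_basis_of_pid (Pi.basisFun ℤ s)
  have hn : n ≤ s.card := by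
    have h := Submodule.finrank_le N
    rw [Module.finrank_eq_card_basis b] at h
    simpa using h
  have hT : Subgroup.closure (Set.range fun i => (L (b i).1).toMul) = T := by
    apply le_antisymm
    · rw [Subgroup.closure_le]
      rintro _ ⟨i, rfl⟩
      exact (b i).2
    · intro x hx
      obtain ⟨v, rfl⟩ := hL x
      have hv : v ∈ N := hx
      have hsum := congrArg Subtype.val (b.sum_repr ⟨v, hv⟩)
      simp only [AddSubmonoidClass.coe_finsetSum, Submodule.coe_smul] at hsum
      rw [← hsum, map_sum, toMul_sum]
      refine prod_mem fun i _ => ?_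
      rw [map_smul, toMul_zsmul]
      exact Subgroup.zpow_mem _ (Subgroup.subset_closure (Set.mem_range_self i)) _
  have : Group.FG (Subgroup.closure (Set.range fun i => (L (b i).1).toMul)) := by
    rw [hT]; infer_instance
  calc Group.rank T
      = Group.rank (Subgroup.closure (Set.range fun i => (L (b i).1).toMul)) :=
        Subgroup.rank_congr hT.symm
    _ ≤ Nat.card (Set.range fun i => (L (b i).1).toMul) :=
        Subgroup.rank_closure_finite_le_nat_card _
    _ ≤ Nat.card (Fin n) := Finite.card_range_le _
    _ ≤ Group.rank A := by simpa [← hs] using hn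

end Group

namespace Bogomolov

/-! ### The crossed module `G ∧ G → G`. -/

section ExteriorSquare

variable {G H : Type*} [Group G] [Group H]

theorem map_rconj (f : G →* H) (x y : G) : f (rconj x y) = rconj (f x) (f y) := by
  simp [rconj]

theorem map_comm (f : G →* H) (x y : G) : f (comm x y) = comm (f x) (f y) := by
  simp [comm]

theorem wedge_self (x : G) : wedge x x = 1 :=
  PresentedGroup.one_of_mem (rels := extRels G) (Or.inr ⟨x, rfl⟩)

/-- The functorial map of exterior squares, `x ∧ y ↦ f x ∧ f y`. -/
def wedgeMap (f : G →* H) : ExtSquare G →* ExtSquare H :=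
  PresentedGroup.toGroup (f := fun p : G × G => wedge (f p.1) (f p.2)) <| by
    rintro r ((⟨x, y, z, rfl⟩ | ⟨x, y, z, rfl⟩) | ⟨x, rfl⟩)
    · simp [sym, map_rconj, wedge_mul_left]
    · simp [sym, map_rconj, wedge_mul_right]
    · simp [sym, wedge_self]

theorem wedgeMap_wedge (f : G →* H) (x y : G) : wedgeMap f (wedge x y) = wedge (f x) (f y) :=
  PresentedGroup.toGroup.of _

@[ext]
theorem hom_ext {f g : ExtSquare G →* H} (h : ∀ x y, f (wedge x y) = g (wedge x y)) : f = g :=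
  PresentedGroup.ext fun p => h p.1 p.2

theorem commMap_wedgeMap (f : G →* H) (w : ExtSquare G) :
    commMap H (wedgeMap f w) = f (commMap G w) := by
  have : (commMap H).comp (wedgeMap f) = f.comp (commMap G) := by
    ext x y
    simp [wedgeMap_wedge, commMap_wedge, map_comm]
  exact DFunLike.congr_fun this w

/-- The diagonal action of `G` on its exterior square, from the right. -/
def act (z : G) : ExtSquare G →* ExtSquare G := wedgeMap (MulAut.conj z⁻¹).toMonoidHom

theorem act_wedge (z x y : G) : act z (wedge x y) = wedge (rconj x z) (rconj y z) := by
  simp [act, wedgeMap_wedge, rconj]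

theorem act_act (x y : G) (w : ExtSquare G) : act y (act x w) = act (x * y) w := by
  have : (act y).comp (act x) = act (x * y) := by
    ext a b
    simp [act_wedge, rconj_rconj]
  exact DFunLike.congr_fun this w

theorem act_one (w : ExtSquare G) : act 1 w = w := by
  have : act (1 : G) = MonoidHom.id _ := by
    ext a b
    simp [act_wedge, rconj]
  exact DFunLike.congr_fun this w

theorem act_injective (z : G) : Function.Injective (act z) := by
  refine Function.LeftInverse.injective (g := act z⁻¹) fun w => ?_
  rw [act_act, mul_inv_cancel, act_one]

theorem wedge_mul_left' (x y z : G) : wedge (x * y) z = act y (wedge x z) * wedge y z := by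
  rw [wedge_mul_left, act_wedge]

theorem wedge_mul_right' (x y z : G) : wedge x (y * z) = wedge x z * act z (wedge x y) := by
  rw [wedge_mul_right, act_wedge]

theorem wedge_one_left (x : G) : wedge 1 x = 1 := by
  have h := wedge_mul_left' 1 1 x
  rwa [mul_one, act_one, left_eq_mul] at h

theorem wedge_one_right (x : G) : wedge x 1 = 1 := by
  have h := wedge_mul_right' x 1 1
  rwa [mul_one, act_one, left_eq_mul] at h

/-- Expand `xy ∧ xy = 1`. -/
theorem wedge_mul_wedge_swap (x y : G) : wedge x y * wedge y x = 1 := by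
  apply act_injective y
  have h := wedge_self (x * y)
  rwa [wedge_mul_left', wedge_mul_right', wedge_mul_right', wedge_self, wedge_self, map_one,
    mul_one, one_mul, ← map_mul, ← map_one (act y)] at h

theorem wedge_swap (x y : G) : wedge y x = (wedge x y)⁻¹ :=
  (inv_eq_of_mul_eq_one_right (wedge_mul_wedge_swap x y)).symm

@[elab_as_elim]
theorem wedge_induction {p : ExtSquare G → Prop} (wedge : ∀ x y, p (wedge x y)) (one : p 1)
    (mul : ∀ v w, p v → p w → p (v * w)) (inv : ∀ v, p v → p v⁻¹) (w : ExtSquare G) : p w := by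
  have hw : w ∈ Subgroup.closure (Set.range fun q : G × G => Bogomolov.wedge q.1 q.2) := by
    rw [closure_wedge]; trivial
  induction hw using Subgroup.closure_induction with
  | mem x hx => obtain ⟨q, rfl⟩ := hx; exact wedge _ _
  | one => exact one
  | mul v w _ _ hv hw => exact mul v w hv hw
  | inv v _ hv => exact inv v hv

/-- The Peiffer identity; `wedge_conj` is the case of a generator `w`. -/
theorem conj_eq_act (w v : ExtSquare G) : w⁻¹ * v * w = act (commMap G w) v := by
  induction w using wedge_induction generalizing v with
  | wedge x y =>
    have : (MulAut.conj (wedge x y)⁻¹).toMonoidHom = act (comm x y) := by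
      ext a b
      simp [act_wedge, ← wedge_conj]
    simpa [commMap_wedge] using DFunLike.congr_fun this v
  | one => simp [act_one]
  | mul u w hu hw => rw [map_mul, ← act_act, ← hu, ← hw]; group
  | inv u hu =>
    apply act_injective (commMap G u)
    rw [act_act, map_inv, inv_mul_cancel, act_one, ← hu]; group

/-- Write `[x, y] = x⁻¹ x^y` and expand on the left; `x^y ∧ z` is `x ∧ yzy⁻¹` acted on by `y`, which
is expanded on the right. -/
theorem inv_mul_act_wedge (x y z : G) :
    (wedge x y)⁻¹ * act z (wedge x y) = wedge (comm x y) z := by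
  have h1 : wedge (comm x y) z = act (rconj x y) (wedge x⁻¹ z) * wedge (rconj x y) z := by
    rw [← wedge_mul_left']; congr 1; simp only [comm, rconj]; group
  have h2 : act x (wedge x⁻¹ z) = (wedge x z)⁻¹ := by
    rw [eq_inv_iff_mul_eq_one, ← wedge_mul_left', inv_mul_cancel, wedge_one_left]
  have h3 : act (rconj x y) (wedge x⁻¹ z) = (wedge x y)⁻¹ * (wedge x z)⁻¹ * wedge x y := by
    rw [conj_eq_act, commMap_wedge, ← h2, act_act]; congr 1; simp only [comm, rconj]; group
  have h4 : act y (wedge x y⁻¹) = (wedge x y)⁻¹ := by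
    rw [eq_inv_iff_mul_eq_one, mul_eq_one_comm, ← wedge_mul_right', inv_mul_cancel, wedge_one_right]
  have h5 : wedge (rconj x y) z = act y (wedge x (y * z * y⁻¹)) := by
    rw [act_wedge]; congr 1; simp only [rconj]; group
  rw [h1, h3, h5, wedge_mul_right', map_mul, act_act, inv_mul_cancel, act_one, h4,
    wedge_mul_right']
  group

/-- Compare `[∂w, z] = w⁻¹ w ^ z` in the crossed module `G ∧ G → G`. -/
theorem act_eq_mul_wedge (w : ExtSquare G) (z : G) :
    act z w = w * wedge (commMap G w) z := by
  induction w using wedge_induction with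
  | wedge x y => rw [commMap_wedge, ← inv_mul_act_wedge, mul_inv_cancel_left]
  | one => rw [map_one, map_one, wedge_one_left, mul_one]
  | mul u w hu hw =>
    rw [map_mul, map_mul, wedge_mul_left', ← conj_eq_act, hu, hw]; group
  | inv u hu =>
    have h : wedge (commMap G u * (commMap G u)⁻¹) z = 1 := by
      rw [mul_inv_cancel, wedge_one_left]
    rw [wedge_mul_left', ← map_inv, ← conj_eq_act] at h
    rw [map_inv, hu]
    rw [mul_eq_one_iff_inv_eq] at h
    rw [← h]; group

theorem wedge_commMap_commMap (v w : ExtSquare G) :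
    wedge (commMap G v) (commMap G w) = v⁻¹ * w⁻¹ * v * w := by
  have h := conj_eq_act w v
  rw [act_eq_mul_wedge] at h
  rw [mul_assoc v⁻¹, mul_assoc v⁻¹, h, inv_mul_cancel_left]

end ExteriorSquare

/-! ### Finiteness of the exterior square. -/

section Finiteness

variable {G : Type*} [Group G] [Finite G]

instance finite_commutatorSet : Finite (commutatorSet (ExtSquare G)) := by
  refine (Set.Finite.subset (Set.finite_range fun p : G × G => wedge p.1 p.2) ?_).to_subtype
  rintro _ ⟨v, w, rfl⟩
  -- The inverses pass from `⁅v, w⁆ = v w v⁻¹ w⁻¹` to the right-handed commutator.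
  refine ⟨(commMap G v⁻¹, commMap G w⁻¹), ?_⟩
  simp only [wedge_commMap_commMap, commutatorElement_def, inv_inv]

/-- Averaging: reindexing `w = ∏ q ∧ y` by `q ↦ qx` gives `w = w^x (x ∧ y)^|G|`. As `w^|G|` lies in
`M G`, it is fixed by `x`, and a further `|G|`-th power cancels it. -/
theorem of_wedge_pow (x y : G) :
    (Abelianization.of (wedge x y)) ^ (Nat.card G * Nat.card G) = 1 := by
  classical
  have := Fintype.ofFinite G
  let φ : Abelianization (ExtSquare G) →* Abelianization (ExtSquare G) :=
    Abelianization.map (act x)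
  have hφ : ∀ w, φ (Abelianization.of w) = Abelianization.of (act x w) := fun w => rfl
  obtain ⟨w, hw⟩ : ∃ w : ExtSquare G, Abelianization.of w =
      ∏ q : G, Abelianization.of (wedge q y) := QuotientGroup.mk_surjective _
  have h1 : Abelianization.of w =
      φ (Abelianization.of w) * Abelianization.of (wedge x y) ^ Nat.card G := by
    conv_lhs => rw [hw, ← Equiv.prod_comp (Equiv.mulRight x)]
    simp only [Equiv.coe_mulRight, wedge_mul_left', map_mul, ← hφ]
    rw [Finset.prod_mul_distrib, ← map_prod, ← hw, Finset.prod_const, Finset.card_univ,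
      Nat.card_eq_fintype_card]
  have h2 : act x (w ^ Nat.card G) = w ^ Nat.card G := by
    rw [act_eq_mul_wedge, map_pow, pow_card_eq_one', wedge_one_left, mul_one]
  have h3 := congrArg (· ^ Nat.card G) h1
  simp only [mul_pow, ← map_pow, hφ] at h3
  rw [map_pow (act x)] at h2
  rw [← h2] at h3
  simp only [map_pow, h2, left_eq_mul] at h3
  rwa [pow_mul]

/-- The exterior square of a finite group is finite. -/
instance finite_extSquare : Finite (ExtSquare G) := by
  have hfg : Group.FG (ExtSquare G) :=
    Group.fg_of_surjective (PresentedGroup.mk_surjective (extRels G))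
  have hfg' : Group.FG (Abelianization (ExtSquare G)) :=
    Group.fg_of_surjective (QuotientGroup.mk'_surjective _)
  have hpow : ∀ a : Abelianization (ExtSquare G), a ^ (Nat.card G * Nat.card G) = 1 := by
    have h : (powMonoidHom (Nat.card G * Nat.card G)).comp
        (Abelianization.of (G := ExtSquare G)) = 1 := by
      ext x y
      exact of_wedge_pow x y
    intro a
    obtain ⟨w, rfl⟩ := QuotientGroup.mk_surjective a
    exact DFunLike.congr_fun h w
  have hfin : Finite (Abelianization (ExtSquare G)) :=
    CommGroup.finite_of_fg_isMulTorsion _ fun a =>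
      isOfFinOrder_iff_pow_eq_one.2 ⟨_, Nat.mul_pos Nat.card_pos Nat.card_pos, hpow a⟩
  have : Finite (ExtSquare G ⧸ commutator (ExtSquare G)) := hfin
  -- A finite set of commutators makes the derived subgroup finite (Schur).
  exact Finite.of_subgroup_quotient (commutator (ExtSquare G))

end Finiteness

/-! ### The exact sequence for a cyclic quotient. -/

section CyclicQuotient

variable {Q : Type*} [Group Q] (S : Subgroup Q)

/-- The subgroup of `Q ∧ Q` generated by the image of `S ∧ S` and by `M₀(Q)`. -/
def relSub : Subgroup (ExtSquare Q) := (wedgeMap S.subtype).range ⊔ M₀ Q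

variable {S}

theorem wedge_mem_relSub {s t : Q} (hs : s ∈ S) (ht : t ∈ S) : wedge s t ∈ relSub S :=
  Subgroup.mem_sup_left ⟨wedge ⟨s, hs⟩ ⟨t, ht⟩, wedgeMap_wedge _ _ _⟩

theorem wedge_mem_relSub_of_comm {x y : Q} (h : comm x y = 1) : wedge x y ∈ relSub S :=
  Subgroup.mem_sup_right (Subgroup.subset_closure ⟨x, y, h, rfl⟩)

theorem commMap_mem_of_isCyclic [S.Normal] [IsCyclic (Q ⧸ S)] (w : ExtSquare Q) :
    commMap Q w ∈ S := by
  have h : (QuotientGroup.mk' S).comp (commMap Q) = 1 := by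
    ext x y
    let _ := IsCyclic.commGroup (α := Q ⧸ S)
    have hc := mul_comm (x : Q ⧸ S) y
    simp only [MonoidHom.comp_apply, commMap_wedge, map_comm, MonoidHom.one_apply]
    simp only [comm, QuotientGroup.mk'_apply]
    rw [← mul_inv_rev, mul_assoc, inv_mul_eq_one]
    exact hc.symm
  simpa using DFunLike.congr_fun h w

theorem inv_mul_inv_mul_mul_mem_relSub [S.Normal] [IsCyclic (Q ⧸ S)] (v w : ExtSquare Q) :
    v⁻¹ * w⁻¹ * v * w ∈ relSub S := by
  rw [← wedge_commMap_commMap]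
  exact wedge_mem_relSub (commMap_mem_of_isCyclic v) (commMap_mem_of_isCyclic w)

instance relSub_normal [S.Normal] [IsCyclic (Q ⧸ S)] : (relSub S).Normal where
  conj_mem v hv w := by
    have h := mul_mem hv (inv_mul_inv_mul_mul_mem_relSub (S := S) v w⁻¹)
    simpa [mul_assoc] using h

theorem quotient_relSub_mul_comm [S.Normal] [IsCyclic (Q ⧸ S)]
    (a b : ExtSquare Q ⧸ relSub S) : a * b = b * a := by
  obtain ⟨v, rfl⟩ := QuotientGroup.mk_surjective a
  obtain ⟨w, rfl⟩ := QuotientGroup.mk_surjective b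
  rw [← QuotientGroup.mk_mul, ← QuotientGroup.mk_mul, eq_comm, QuotientGroup.eq]
  simpa [mul_assoc] using inv_mul_inv_mul_mul_mem_relSub (S := S) v w

/-- The homomorphism `s ↦ s ∧ g` from `S` to `Q ∧ Q` modulo `S ∧ S` and `M₀(Q)`. -/
def wedgeRight [S.Normal] [IsCyclic (Q ⧸ S)] (g : Q) : S →* ExtSquare Q ⧸ relSub S where
  toFun s := (wedge s.1 g : ExtSquare Q)
  map_one' := by
    rw [Subgroup.coe_one, wedge_one_left]; rfl
  map_mul' s t := by
    -- The action of `t` changes `s ∧ g` only by the factor `[s, g] ∧ t`, which lies in the image of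
    -- `S ∧ S`.
    rw [Subgroup.coe_mul, wedge_mul_left', act_eq_mul_wedge, QuotientGroup.mk_mul,
      QuotientGroup.mk_mul,
      (QuotientGroup.eq_one_iff _).2 (wedge_mem_relSub (commMap_mem_of_isCyclic _) t.2), mul_one]

theorem wedgeRight_surjective [S.Normal] [IsCyclic (Q ⧸ S)] {g : Q}
    (hg : ∀ x : Q, ∃ s ∈ S, ∃ n : ℕ, x = s * g ^ n) :
    Function.Surjective (wedgeRight (S := S) g) := by
  let R : Subgroup (ExtSquare Q) := (wedgeRight (S := S) g).range.comap (QuotientGroup.mk' _)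
  have hIR : ∀ v ∈ relSub S, v ∈ R := fun v hv => by
    rw [Subgroup.mem_comap, QuotientGroup.mk'_apply, (QuotientGroup.eq_one_iff v).2 hv]
    exact one_mem _
  have hconj : ∀ {s : Q} (x : Q), s ∈ S → rconj s x ∈ S := fun {s} x hs => by
    simpa [rconj] using (inferInstance : S.Normal).conj_mem s hs x⁻¹
  have hSg : ∀ s ∈ S, wedge s g ∈ R := fun s hs => ⟨⟨s, hs⟩, rfl⟩
  have hSpow : ∀ s ∈ S, ∀ n : ℕ, wedge s (g ^ n) ∈ R := by
    intro s hs n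
    induction n with
    | zero => rw [pow_zero, wedge_one_right]; exact one_mem _
    | succ n ih =>
      rw [pow_succ', wedge_mul_right', act_wedge]
      refine mul_mem ih ?_
      have : rconj g (g ^ n) = g := by
        rw [rconj, mul_assoc, ← pow_succ', pow_succ, inv_mul_cancel_left]
      rw [this]
      exact hSg _ (hconj _ hs)
  have hSQ : ∀ s ∈ S, ∀ x, wedge s x ∈ R := by
    intro s hs x
    obtain ⟨t, ht, n, rfl⟩ := hg x
    rw [wedge_mul_right', act_wedge]
    exact mul_mem (hSpow s hs n) (hIR _ (wedge_mem_relSub (hconj _ hs) (hconj _ ht)))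
  have hQS : ∀ s ∈ S, ∀ x, wedge x s ∈ R := by
    intro s hs x
    rw [wedge_swap s x]
    exact inv_mem (hSQ s hs x)
  have hR : ∀ v, v ∈ R := by
    intro v
    induction v using wedge_induction with
    | wedge x y =>
      obtain ⟨s, hs, m, rfl⟩ := hg x
      obtain ⟨t, ht, n, rfl⟩ := hg y
      rw [wedge_mul_left', act_wedge, wedge_mul_right' (g ^ m), act_wedge]
      -- The only factor with no entry in `S` is `g^m ∧ g^n`, and it lies in `M₀ Q`.
      refine mul_mem (hSQ _ (hconj _ hs) _) (mul_mem (hIR _ (wedge_mem_relSub_of_comm ?_))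
        (hQS _ (hconj _ ht) _))
      rw [comm, ← mul_inv_rev, mul_assoc, inv_mul_eq_one, ← pow_add, ← pow_add, add_comm]
    | one => exact one_mem _
    | mul v w hv hw => exact mul_mem hv hw
    | inv v hv => exact inv_mem hv
  intro a
  obtain ⟨v, rfl⟩ := QuotientGroup.mk_surjective a
  exact hR v

theorem exists_eq_mul_pow_of_isCyclic [Finite Q] [S.Normal] [IsCyclic (Q ⧸ S)] :
    ∃ g : Q, ∀ x : Q, ∃ s ∈ S, ∃ n : ℕ, x = s * g ^ n := by
  obtain ⟨a, ha⟩ := IsCyclic.exists_monoid_generator (α := Q ⧸ S)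
  obtain ⟨g, rfl⟩ := QuotientGroup.mk_surjective a
  refine ⟨g, fun x => ?_⟩
  obtain ⟨n, hn⟩ := ha x
  refine ⟨x * (g ^ n)⁻¹, ?_, n, by simp⟩
  rw [← QuotientGroup.eq_one_iff, QuotientGroup.mk_mul, QuotientGroup.mk_inv,
    QuotientGroup.mk_pow, mul_inv_eq_one]
  exact hn.symm

/-- The surjection from `S` modulo commutators induced by `s ↦ s ∧ g`. -/
def abWedgeRight [S.Normal] [IsCyclic (Q ⧸ S)] (g : Q) :
    Abelianization S →* ExtSquare Q ⧸ relSub S :=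
  QuotientGroup.lift (commutator S) (wedgeRight g) <| by
    rw [commutator_def, Subgroup.commutator_le]
    intro s _ t _
    rw [MonoidHom.mem_ker, map_commutatorElement, commutatorElement_eq_one_iff_mul_comm]
    exact quotient_relSub_mul_comm _ _

theorem abWedgeRight_surjective [S.Normal] [IsCyclic (Q ⧸ S)] {g : Q}
    (hg : ∀ x : Q, ∃ s ∈ S, ∃ n : ℕ, x = s * g ^ n) :
    Function.Surjective (abWedgeRight (S := S) g) := fun a => by
  obtain ⟨s, rfl⟩ := wedgeRight_surjective hg a
  exact ⟨Abelianization.of s, rfl⟩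

variable (S)

/-- The corestriction `B₀(S) → B₀(Q)`. -/
def cores : B₀ S →* B₀ Q :=
  QuotientGroup.map _ _
    (((wedgeMap S.subtype).comp (M S).subtype).codRestrict (M Q) fun w => by
      rw [M, MonoidHom.mem_ker, MonoidHom.comp_apply, commMap_wedgeMap]
      exact (congrArg S.subtype w.2).trans (map_one _)) <| by
    have h : M₀ S ≤ (M₀ Q).comap (wedgeMap S.subtype) := by
      rw [M₀, Subgroup.closure_le]
      rintro _ ⟨x, y, hxy, rfl⟩
      refine Subgroup.subset_closure ⟨S.subtype x, S.subtype y, ?_, wedgeMap_wedge _ _ _⟩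
      rw [← map_comm, hxy, map_one]
    exact fun _ hw => h hw

/-- The map from `B₀(Q)` to `Q ∧ Q` modulo `S ∧ S` and `M₀(Q)`. -/
def toQuotient [S.Normal] [IsCyclic (Q ⧸ S)] : B₀ Q →* ExtSquare Q ⧸ relSub S :=
  QuotientGroup.lift _ ((QuotientGroup.mk' (relSub S)).comp (M Q).subtype) fun _ hw =>
    (QuotientGroup.eq_one_iff _).2 (Subgroup.mem_sup_right hw)

/-- If `m = u w` lies in `M Q`, with `u` from `S ∧ S` and `w` in `M₀ Q ≤ M Q`, then `∂u = 1` in `Q`,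
hence already in `S`. -/
theorem range_cores [S.Normal] [IsCyclic (Q ⧸ S)] : (cores S).range = (toQuotient S).ker := by
  apply le_antisymm
  · rintro _ ⟨a, rfl⟩
    obtain ⟨m, rfl⟩ := QuotientGroup.mk_surjective a
    exact (QuotientGroup.eq_one_iff _).2 (Subgroup.mem_sup_left ⟨m.1, rfl⟩)
  · intro a ha
    obtain ⟨m, rfl⟩ := QuotientGroup.mk_surjective a
    have hm : m.1 ∈ relSub S := (QuotientGroup.eq_one_iff _).1 ((MonoidHom.mem_ker).1 ha)
    rw [relSub, Subgroup.mem_sup_of_normal_right] at hm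
    obtain ⟨_, ⟨u, rfl⟩, w, hw, huw⟩ := hm
    have hu : u ∈ M S := by
      rw [M, MonoidHom.mem_ker]
      apply S.subtype_injective
      have h1 : commMap Q m.1 = 1 := m.2
      have h2 : commMap Q w = 1 := M₀_le_M hw
      rw [← huw, map_mul, h2, mul_one, commMap_wedgeMap] at h1
      rw [h1, map_one]
    refine ⟨((⟨u, hu⟩ : M S) : B₀ S), ?_⟩
    refine QuotientGroup.eq.2 ?_
    rw [Subgroup.mem_subgroupOf]
    have : w = (wedgeMap S.subtype u)⁻¹ * m.1 := by rw [← huw, inv_mul_cancel_left]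
    rw [this] at hw
    exact hw

end CyclicQuotient

end Bogomolov

/-! ### The bounds on order and number of generators. -/

open Bogomolov in
/-- Here `Group.rank` is the minimal number of generators, `d`. -/
theorem proposition6p1 {Q : Type*} [Group Q] [Finite Q] (S : Subgroup Q) [S.Normal]
    (hcyc : IsCyclic (Q ⧸ S)) :
    Finite (Bogomolov.B₀ Q) ∧ Finite (Bogomolov.B₀ S) ∧
    Nat.card (Bogomolov.B₀ Q) ∣ Nat.card (Bogomolov.B₀ S) * Nat.card (Abelianization S) ∧
    Group.rank (Bogomolov.B₀ Q) ≤
      Group.rank (Bogomolov.B₀ S) + Group.rank (Abelianization S) := by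
  obtain ⟨g, hg⟩ := exists_eq_mul_pow_of_isCyclic (S := S)
  have hsurj := abWedgeRight_surjective (S := S) hg
  have hQ : Finite (B₀ Q) := inferInstance
  have hS : Finite (B₀ S) := inferInstance
  refine ⟨hQ, hS, ?_, ?_⟩
  · rw [← (toQuotient S).ker.card_mul_index, Subgroup.index_ker, ← range_cores]
    exact mul_dvd_mul (Subgroup.card_range_dvd _)
      ((Subgroup.card_subgroup_dvd_card _).trans (Subgroup.card_dvd_of_surjective _ hsurj))
  · have hker : Group.rank (toQuotient S).ker ≤ Group.rank (B₀ S) := by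
      rw [← Subgroup.rank_congr (range_cores S)]
      exact Group.rank_range_le
    -- The range sits in a quotient of the abelianization of `S`, so its generators are bounded
    -- through its preimage there.
    let T := (toQuotient S).range.comap (abWedgeRight (S := S) g)
    have hrange : Group.rank (toQuotient S).range ≤ Group.rank (Abelianization S) :=
      (Group.rank_le_of_surjective ((abWedgeRight (S := S) g).subgroupComap (toQuotient S).range)
        (MonoidHom.subgroupComap_surjective_of_surjective _ _ hsurj)).trans
        (Group.rank_subgroup_le T)
    exact (Group.rank_le_rank_ker_add_rank_range (toQuotient S)).trans (add_le_add hker hrange)
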